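/- **Lemma (main parabolic error equation).** Let $d\ge1$, let $\Omega\subset\mathbb R^d$ be a bounded convex polygonal (polyhedral) domain and $T>0$. Write $(\cdot,\cdot)$ for the inner product of $L^2(\Omega)$ and of $L^2(\Omega)^d$, and $\langle\cdot,\cdot\rangle$ for the pairing of $H^{-1}(\Omega)=H^1_0(\Omega)'$ with $H^1_0(\Omega)$, where $L^2(\Omega)\subset H^{-1}(\Omega)$ through $\langle v,\phi\rangle=(v,\phi)$. Let $A\in L^\infty(\Omega)^{d\times d}$ and $a(v,\psi)=(A\nabla v,\nabla\psi)$ for $v,\psi\in H^1_0(\Omega)$, and assume that, for some $\alpha,\beta>0$, $a(\psi,\phi)\le\beta\|\nabla\psi\|\,\|\nabla\phi\|$ and $a(\phi,\phi)\ge\alpha\|\nabla\phi\|^2$ for all $\phi,\psi\in H^1_0(\Omega)$. Let $f\in L^2(0,T;L^2(\Omega))$ be given with well-defined values $f(t)\in L^2(\Omega)$ at all $t\in[0,T]$, and let $g\in H^1_0(\Omega)$. Let $u\in L^\infty(0,T;H^1_0(\Omega))$, with weak time derivative $\partial_tu\in L^2(0,T;L^2(\Omega))$, satisfy $u(0)=g$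 and, for all $\phi\in H^1_0(\Omega)$, $$\langle\partial_tu,\phi\rangle+a(u,\phi)=(f,\phi)\quad\text{a.e. in }(0,T).$$ Let $0=t_0<t_1<\dots<t_N=T$, $\tau_n=t_n-t_{n-1}$, $I_n=[t_{n-1},t_n)$ and $f^n=f(t_n)$. For $0\le n\le N$ let $\mathcal T_n$ be a conforming (simplicial) triangulation of $\Omega$ and let $V^n$ be the space of all $\phi\in H^1_0(\Omega)$ whose restriction to each element of $\mathcal T_n$ is a polynomial of degree at most $\ell$. Let $U^0=I^0g$, where $I^0$ is any map from $H^1_0(\Omega)$ to $V^0$, and for $1\le n\le N$ let $U^n\in V^n$ satisfy $$\tau_n^{-1}(U^n-U^{n-1},\phi_n)+a(U^n,\phi_n)=(f^n,\phi_n)\qquad\text{for all }\phi_n\in V^n.$$ Let $P^n:L^2(\Omega)\to V^n$ be the $L^2$-projection: $(P^nv,\phi_n)=(v,\phi_n)$ for all $\phi_n\in V^n$. Let $A^n:H^1_0(\Omega)\to V^n$ be defined by $(A^nv,\phi_n)=a(v,\phi_n)$ for all $\phi_n\in V^n$, and the elliptic reconstruction $\mathcal R^n:H^1_0(\Omega)\to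 H^1_0(\Omega)$ by $a(\mathcal R^nv,\phi)=(A^nv,\phi)$ for all $\phi\in H^1_0(\Omega)$. Let $U(t)$ and $\omega(t)$, $t\in[0,T]$, be the continuous functions of time that are affine on each $[t_{n-1},t_n]$ and take the values $U^n$ and $\omega^n:=\mathcal R^nU^n$, respectively, at $t_n$ ($0\le n\le N$). Put $\rho=\omega-u$ and $\varepsilon=\omega-U$. Then $\rho$ and $\varepsilon$ have weak time derivatives $\partial_t\rho,\partial_t\varepsilon\in L^2(0,T;L^2(\Omega))$ and, for each $n\in\{1,\dots,N\}$ and almost every $t\in I_n$, for all $\phi\in H^1_0(\Omega)$, $$\langle\partial_t\rho,\phi\rangle+a(\rho,\phi)=(\partial_t\varepsilon,\phi)+a(\omega-\omega^n,\phi)+(P^nf^n-f,\phi)+\tau_n^{-1}(P^nU^{n-1}-U^{n-1},\phi),$$ where $\rho,\varepsilon,\omega,f$ and the time derivatives are evaluated at $t$. -/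

import Mathlib

open MeasureTheory Set

noncomputable section

namespace ParabolicFEM

open scoped ContDiff Matrix

/-- The Euclidean space `ℝ^d`. -/
abbrev Rd (d : ℕ) : Type := EuclideanSpace ℝ (Fin d)

/-- `Ω` is a (bounded, open, non-empty) convex polygonal (polyhedral) domain of `ℝ^d`: the interior
of the convex hull of finitely many points, with non-empty interior. -/
def IsConvexPolygonalDomain {d : ℕ} (Ω : Set (Rd d)) : Prop :=
  Ω.Nonempty ∧ ∃ s : Set (Rd d), s.Finite ∧ Ω = interior (convexHull ℝ s)

/-- The Hilbert space `L²(Ω)`; its inner product is `(φ, ψ) = ∫_Ω φ ψ`. -/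
abbrev L2 {d : ℕ} (Ω : Set (Rd d)) : Type := Lp ℝ 2 (volume.restrict Ω)

/-- The Hilbert space `L²(Ω; ℝ^d)` of square integrable vector fields. -/
abbrev L2Vec {d : ℕ} (Ω : Set (Rd d)) : Type := Lp (Rd d) 2 (volume.restrict Ω)

/-- The Hilbert space in which `H¹(Ω)` is embedded by `v ↦ (v, ∇v)`; its norm restricts to the full
`H¹` norm `(‖v‖² + ‖∇v‖²)^{1/2}`. -/
abbrev GraphSpace {d : ℕ} (Ω : Set (Rd d)) : Type := WithLp 2 (L2 Ω × L2Vec Ω)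

/-- The set of pairs `(φ, ∇φ)` with `φ ∈ C_c^∞(Ω)`. -/
def testGraph {d : ℕ} (Ω : Set (Rd d)) : Set (GraphSpace Ω) :=
  {p | ∃ φ : Rd d → ℝ, ContDiff ℝ ∞ φ ∧ HasCompactSupport φ ∧ tsupport φ ⊆ Ω ∧
    p.fst =ᵐ[volume.restrict Ω] φ ∧ p.snd =ᵐ[volume.restrict Ω] gradient φ}

/-- The Sobolev space `H¹₀(Ω)`: the closure of `C_c^∞(Ω)` in the `H¹` norm.  An element is recorded
as the pair of the function and its weak gradient (for open `Ω` the second component is the weak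
gradient of the first one, hence is determined by it). -/
def H10 {d : ℕ} (Ω : Set (Rd d)) : Submodule ℝ (GraphSpace Ω) :=
  (Submodule.span ℝ (testGraph Ω)).topologicalClosure

/-- The inclusion `H¹₀(Ω) ⊂ L²(Ω)`. -/
def fn {d : ℕ} {Ω : Set (Rd d)} : H10 Ω →L[ℝ] L2 Ω :=
  (WithLp.fstL 2 ℝ (L2 Ω) (L2Vec Ω)).comp (H10 Ω).subtypeL

/-- The weak spatial gradient `∇v ∈ L²(Ω; ℝ^d)` of `v ∈ H¹₀(Ω)`. -/
def grad {d : ℕ} {Ω : Set (Rd d)} : H10 Ω →L[ℝ] L2Vec Ω :=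
  (WithLp.sndL 2 ℝ (L2 Ω) (L2Vec Ω)).comp (H10 Ω).subtypeL

/-- The bilinear form `a(v, ψ) = ∫_Ω (A ∇v) · ∇ψ`. -/
def bilin {d : ℕ} {Ω : Set (Rd d)} (A : Rd d → Matrix (Fin d) (Fin d) ℝ) (v ψ : H10 Ω) : ℝ :=
  ∫ x in Ω, (A x *ᵥ (grad v x).ofLp) ⬝ᵥ (grad ψ x).ofLp

/-- The assumptions on the coefficient matrix: `A ∈ L^∞(Ω)^{d×d}`, and `a` is bounded with constant
`β > 0` and coercive with constant `α > 0` for `|φ|₁ = ‖∇φ‖`. -/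
structure IsAdmissibleCoefficient {d : ℕ} (Ω : Set (Rd d))
    (A : Rd d → Matrix (Fin d) (Fin d) ℝ) (α β : ℝ) : Prop where
  memLp_top : ∀ i j, MemLp (fun x => A x i j) ⊤ (volume.restrict Ω)
  alpha_pos : 0 < α
  beta_pos : 0 < β
  bounded : ∀ ψ φ : H10 Ω, bilin A ψ φ ≤ β * ‖grad ψ‖ * ‖grad φ‖
  coercive : ∀ φ : H10 Ω, α * ‖grad φ‖ ^ 2 ≤ bilin A φ φ

/-- The embedding `L²(Ω) ∼ L²(Ω)' ⊂ H⁻¹(Ω)`, where `H⁻¹(Ω)` is the dual of `H¹₀(Ω)`: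
`⟨v, φ⟩ = (v, φ)`. -/
def toHMinusOne {d : ℕ} {Ω : Set (Rd d)} (v : L2 Ω) : StrongDual ℝ (H10 Ω) :=
  (innerSL ℝ v).comp fn

/-- `v'` is the (weak) time derivative of `v` on `(0, T)`, with `v' ∈ L²(0,T;L²(Ω))`:
`∫₀ᵀ η'(s) v(s) ds = - ∫₀ᵀ η(s) v'(s) ds` for all `η ∈ C_c^∞(0,T)`.  Such a `v'` is unique up to
equality almost everywhere. -/
structure IsTimeDeriv {d : ℕ} {Ω : Set (Rd d)} (T : ℝ) (v v' : ℝ → L2 Ω) : Prop where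
  integrable : IntegrableOn v (Ioo 0 T)
  memLp : MemLp v' 2 (volume.restrict (Ioo 0 T))
  integral_eq : ∀ η : ℝ → ℝ, ContDiff ℝ ∞ η → HasCompactSupport η → tsupport η ⊆ Ioo 0 T →
    ∫ s in Ioo 0 T, deriv η s • v s = - ∫ s in Ioo 0 T, η s • v' s

/-- `u` solves the linear parabolic problem with source `f` and initial value `g`:
`u ∈ L^∞(0,T;H¹₀(Ω))`, `∂ₜu ∈ L²(0,T;L²(Ω))`, `⟨∂ₜu, φ⟩ + a(u, φ) = (f, φ)` for all
`φ ∈ H¹₀(Ω)` at almost every time, and `u(0) = g` (for the representative of `u` in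
`C([0,T];L²(Ω))`). -/
def IsSolution {d : ℕ} {Ω : Set (Rd d)} (T : ℝ) (A : Rd d → Matrix (Fin d) (Fin d) ℝ)
    (f : ℝ → L2 Ω) (g : H10 Ω) (u : ℝ → H10 Ω) : Prop :=
  MemLp u ⊤ (volume.restrict (Ioo 0 T)) ∧
  (∃ u' : ℝ → L2 Ω, IsTimeDeriv T (fun s => fn (u s)) u' ∧
    ∀ φ : H10 Ω, ∀ᵐ s ∂(volume.restrict (Ioo 0 T)),
      toHMinusOne (u' s) φ + bilin A (u s) φ = inner ℝ (f s) (fn φ)) ∧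
  ∃ v : ℝ → L2 Ω, ContinuousOn v (Icc 0 T) ∧
    (∀ᵐ s ∂(volume.restrict (Ioo 0 T)), v s = fn (u s)) ∧ v 0 = fn g

/-- A conforming triangulation of `Ω`: a finite simplicial complex (any two simplices meet in a
common face or not at all) whose underlying space is the closure of `Ω` and each of whose simplices
is a face of a `d`-dimensional one. -/
structure Triangulation {d : ℕ} (Ω : Set (Rd d)) where
  complex : Geometry.SimplicialComplex ℝ (Rd d)
  finite : complex.faces.Finite
  space_eq : complex.space = closure Ω
  pure : ∀ s ∈ complex.faces, ∃ K ∈ complex.faces, s ⊆ K ∧ K.card = d + 1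

/-- The vertex sets of the elements (the `d`-dimensional simplices) of a triangulation; the element
itself is the convex hull of its vertex set. -/
def Triangulation.elements {d : ℕ} {Ω : Set (Rd d)} (τ : Triangulation Ω) :
    Set (Finset (Rd d)) :=
  {K | K ∈ τ.complex.faces ∧ K.card = d + 1}

/-- The finite element space of all `φ ∈ H¹₀(Ω)` whose restriction to each element is a polynomial
of total degree at most `ℓ`. -/
def feSpace {d : ℕ} {Ω : Set (Rd d)} (τ : Triangulation Ω) (ℓ : ℕ) : Submodule ℝ (H10 Ω) where
  carrier := {φ | ∀ K ∈ τ.elements, ∃ p : MvPolynomial (Fin d) ℝ, p.totalDegree ≤ ℓ ∧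
    ∀ᵐ x ∂(volume.restrict Ω), x ∈ convexHull ℝ (K : Set (Rd d)) →
      fn φ x = MvPolynomial.eval (fun i => x i) p}
  zero_mem' := by
    intro K _
    refine ⟨0, by simp, ?_⟩
    filter_upwards [Lp.coeFn_zero ℝ 2 (volume.restrict Ω)] with x hx _
    simpa using hx
  add_mem' := by
    intro v w hv hw K hK
    obtain ⟨p, hp, hvp⟩ := hv K hK
    obtain ⟨q, hq, hwq⟩ := hw K hK
    refine ⟨p + q, (MvPolynomial.totalDegree_add p q).trans (max_le hp hq), ?_⟩
    filter_upwards [hvp, hwq, Lp.coeFn_add (fn v) (fn w)] with x h1 h2 h3 hx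
    rw [map_add, h3, Pi.add_apply, h1 hx, h2 hx, map_add]
  smul_mem' := by
    intro c v hv K hK
    obtain ⟨p, hp, hvp⟩ := hv K hK
    refine ⟨c • p, (MvPolynomial.totalDegree_smul_le c p).trans hp, ?_⟩
    filter_upwards [hvp, Lp.coeFn_smul c (fn v)] with x h1 h3 hx
    rw [map_smul, h3, Pi.smul_apply, h1 hx, MvPolynomial.smul_eval, smul_eq_mul]

/-- The `L²`-projection `P v ∈ V` of `v ∈ L²(Ω)`: the element of the (finite dimensional) space `V`
with `(P v, φ) = (v, φ)` for all `φ ∈ V`. -/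
def l2Proj {d : ℕ} {Ω : Set (Rd d)} (V : Submodule ℝ (H10 Ω)) (v : L2 Ω) : V :=
  Classical.epsilon fun w : V => ∀ φ ∈ V, inner ℝ (fn (w : H10 Ω)) (fn φ) = inner ℝ v (fn φ)

/-- The discrete elliptic operator: for `v ∈ H¹₀(Ω)`, the element `w` of the (finite dimensional)
space `V` with `(w, φ) = a(v, φ)` for all `φ ∈ V`. -/
def discreteElliptic {d : ℕ} {Ω : Set (Rd d)} (A : Rd d → Matrix (Fin d) (Fin d) ℝ)
    (V : Submodule ℝ (H10 Ω)) (v : H10 Ω) : V :=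
  Classical.epsilon fun w : V => ∀ φ ∈ V, inner ℝ (fn (w : H10 Ω)) (fn φ) = bilin A v φ

/-- The elliptic reconstruction `R v ∈ H¹₀(Ω)` of `v ∈ H¹₀(Ω)` with respect to `V`: with `w` the
image of `v` under the discrete elliptic operator, the element of `H¹₀(Ω)` with
`a(R v, φ) = (w, φ)` for all `φ ∈ H¹₀(Ω)`. -/
def reconstruction {d : ℕ} {Ω : Set (Rd d)} (A : Rd d → Matrix (Fin d) (Fin d) ℝ)
    (V : Submodule ℝ (H10 Ω)) (v : H10 Ω) : H10 Ω :=
  Classical.epsilon fun r : H10 Ω =>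
    ∀ φ : H10 Ω, bilin A r φ = inner ℝ (fn (discreteElliptic A V v : H10 Ω)) (fn φ)

/-- A partition `0 = t₀ < t₁ < ⋯ < t_N = T` of `[0, T]` (values of `t` beyond `N` are irrelevant). -/
structure IsPartition (T : ℝ) (N : ℕ) (t : ℕ → ℝ) : Prop where
  zero : t 0 = 0
  last : t N = T
  lt : ∀ n, n < N → t n < t (n + 1)

/-- The time step `τ_n = t_n - t_{n-1}`, used for `1 ≤ n ≤ N`. -/
def timeStep (t : ℕ → ℝ) (n : ℕ) : ℝ := t n - t (n - 1)

/-- The hat function `l_n`, for `0 ≤ n ≤ N`: it is `(s - t_{n-1}) / τ_n` on `[t_{n-1}, t_n]`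
(if `n ≥ 1`), `(t_{n+1} - s) / τ_{n+1}` on `[t_n, t_{n+1}]` (if `n < N`), and zero elsewhere. -/
def hat (N : ℕ) (t : ℕ → ℝ) (n : ℕ) (s : ℝ) : ℝ :=
  open scoped Classical in
  if 1 ≤ n ∧ s ∈ Icc (t (n - 1)) (t n) then (s - t (n - 1)) / timeStep t n
  else if n < N ∧ s ∈ Icc (t n) (t (n + 1)) then (t (n + 1) - s) / timeStep t (n + 1)
  else 0

/-- The continuous piecewise linear interpolation in time of the sequence `W⁰, …, W^N`; on
`[t_{n-1}, t_n]` it is `l_{n-1}(s) W^{n-1} + l_n(s) W^n`, since the other hat functions vanish. -/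
def pwLinear {X : Type*} [AddCommGroup X] [Module ℝ X] (N : ℕ) (t : ℕ → ℝ) (W : ℕ → X) (s : ℝ) :
    X :=
  ∑ n ∈ Finset.range (N + 1), hat N t n s • W n

/-- `U⁰, …, U^N` is the solution of the backward Euler–Galerkin scheme for the finite element spaces
`V 0, …, V N`, with `f^n = f(t_n)`: `U⁰ = I⁰ g`, and for `1 ≤ n ≤ N`, `U^n ∈ V n` satisfies
`τ_n⁻¹ (U^n - U^{n-1}, φ) + a(U^n, φ) = (f^n, φ)` for all `φ ∈ V n`. -/
structure IsFullyDiscreteSolution {d : ℕ} {Ω : Set (Rd d)} (N : ℕ) (t : ℕ → ℝ)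
    (A : Rd d → Matrix (Fin d) (Fin d) ℝ) (V : ℕ → Submodule ℝ (H10 Ω)) (f : ℝ → L2 Ω)
    (g : H10 Ω) (I₀ : H10 Ω → V 0) (U : ℕ → H10 Ω) : Prop where
  initial : U 0 = I₀ g
  mem : ∀ n, 1 ≤ n → n ≤ N → U n ∈ V n
  scheme : ∀ n, 1 ≤ n → n ≤ N → ∀ φ ∈ V n,
    (timeStep t n)⁻¹ * inner ℝ (fn (U n) - fn (U (n - 1))) (fn φ) + bilin A (U n) φ =
      inner ℝ (f (t n)) (fn φ)

end ParabolicFEM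

end

noncomputable section

namespace ParabolicFEM

open scoped ContDiff Matrix

variable {d : ℕ} {Ω : Set (Rd d)}

/-! On `I_n` the derivative of `ω - ε = U` is the constant `τ_n⁻¹ (U^n - U^{n-1})`. Subtracting the
weak equation for `u` and moving `∂ₜε` and `a(ω - ω^n, φ)` to the left therefore leaves `τ_n⁻¹ (U^n
- U^{n-1}, φ) + a(ω^n, φ) - (f, φ)`. By the reconstruction, `a(ω^n, φ) = (A^n U^n, φ)` for every `φ`
in `H¹₀(Ω)`, not only for discrete `φ`. The scheme, read as an identity inside `V^n`, says `A^n U^n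
= P^n f^n - τ_n⁻¹ (U^n - P^n U^{n-1})`. Inserting this cancels `U^n` and gives the claim.

Three points carry the work. `P^n`, `A^n` and `R^n` are chosen by `Classical.epsilon`, so
representers must be shown to exist: `l2Proj_spec` rests on the finite dimension of the image of
`V^n` in `L²`, `bilin_reconstruction` on Lax–Milgram, whose coercivity needs the Poincaré
inequality; for `A^n` the scheme itself supplies the representer. The slopes of a piecewise linear
function are its weak derivative (`isTimeDeriv_pwLinear`). Separability of `H¹₀(Ω)` makes the
exceptional null set of times independent of `φ` (`ae_forall_of_forall_ae`). -/

instance completeSpace_H10 : CompleteSpace (H10 Ω) :=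
  (Submodule.isClosed_topologicalClosure _).completeSpace_coe

instance secondCountableTopology_L2 : SecondCountableTopology (L2 Ω) :=
  haveI : Fact ((2 : ENNReal) ≠ ⊤) := ⟨by norm_num⟩
  Lp.SecondCountableTopology

instance secondCountableTopology_L2Vec : SecondCountableTopology (L2Vec Ω) :=
  haveI : Fact ((2 : ENNReal) ≠ ⊤) := ⟨by norm_num⟩
  Lp.SecondCountableTopology

instance secondCountableTopology_H10 : SecondCountableTopology (H10 Ω) :=
  TopologicalSpace.Subtype.secondCountableTopology _

lemma IsConvexPolygonalDomain.isBounded (h : IsConvexPolygonalDomain Ω) :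
    Bornology.IsBounded Ω := by
  obtain ⟨-, s, hs, rfl⟩ := h
  exact (isBounded_convexHull.2 hs.isBounded).subset interior_subset

lemma IsConvexPolygonalDomain.isOpen (h : IsConvexPolygonalDomain Ω) : IsOpen Ω := by
  obtain ⟨-, s, hs, rfl⟩ := h
  exact isOpen_interior

/-! ### The bilinear form `a` as a bounded form on `H¹₀(Ω)`. -/

section Bilin

variable {A : Rd d → Matrix (Fin d) (Fin d) ℝ} {α β : ℝ}

lemma memLp_grad_apply (v : H10 Ω) (i : Fin d) :
    MemLp (fun x => (grad v x).ofLp i) 2 (volume.restrict Ω) :=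
  (EuclideanSpace.proj (𝕜 := ℝ) i).comp_memLp' (Lp.memLp (grad v))

lemma IsAdmissibleCoefficient.integrable (hA : IsAdmissibleCoefficient Ω A α β) (v ψ : H10 Ω) :
    Integrable (fun x => (A x *ᵥ (grad v x).ofLp) ⬝ᵥ (grad ψ x).ofLp) (volume.restrict Ω) := by
  simp only [dotProduct, Matrix.mulVec, Finset.sum_mul]
  refine integrable_finsetSum _ fun i _ => integrable_finsetSum _ fun j _ => ?_
  have h : MemLp (fun x => A x i j * (grad v x).ofLp j) 2 (volume.restrict Ω) :=
    (memLp_grad_apply v j).mul (hA.memLp_top i j)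
  exact h.integrable_mul (memLp_grad_apply ψ i)

lemma bilin_add_left (hA : IsAdmissibleCoefficient Ω A α β) (v w ψ : H10 Ω) :
    bilin A (v + w) ψ = bilin A v ψ + bilin A w ψ := by
  rw [bilin, bilin, bilin, ← integral_add (hA.integrable v ψ) (hA.integrable w ψ)]
  apply integral_congr_ae
  filter_upwards [Lp.coeFn_add (grad v) (grad w)] with x hx
  rw [map_add, hx]
  simp [Matrix.mulVec_add, add_dotProduct]

lemma bilin_add_right (hA : IsAdmissibleCoefficient Ω A α β) (v w ψ : H10 Ω) :
    bilin A ψ (v + w) = bilin A ψ v + bilin A ψ w := by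
  rw [bilin, bilin, bilin, ← integral_add (hA.integrable ψ v) (hA.integrable ψ w)]
  apply integral_congr_ae
  filter_upwards [Lp.coeFn_add (grad v) (grad w)] with x hx
  rw [map_add, hx]
  simp [dotProduct_add]

lemma bilin_smul_left (A : Rd d → Matrix (Fin d) (Fin d) ℝ) (c : ℝ) (v ψ : H10 Ω) :
    bilin A (c • v) ψ = c * bilin A v ψ := by
  rw [bilin, bilin, ← integral_const_mul]
  apply integral_congr_ae
  filter_upwards [Lp.coeFn_smul c (grad v)] with x hx
  simp [map_smul, hx, Matrix.mulVec_smul, smul_dotProduct]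

lemma bilin_smul_right (A : Rd d → Matrix (Fin d) (Fin d) ℝ) (c : ℝ) (v ψ : H10 Ω) :
    bilin A ψ (c • v) = c * bilin A ψ v := by
  rw [bilin, bilin, ← integral_const_mul]
  apply integral_congr_ae
  filter_upwards [Lp.coeFn_smul c (grad v)] with x hx
  simp [map_smul, hx, dotProduct_smul]

lemma norm_sq_eq (v : H10 Ω) : ‖v‖ ^ 2 = ‖fn v‖ ^ 2 + ‖grad v‖ ^ 2 :=
  WithLp.prod_norm_sq_eq_of_L2 (v : GraphSpace Ω)

lemma norm_grad_le (v : H10 Ω) : ‖grad v‖ ≤ ‖v‖ := by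
  exact le_of_pow_le_pow_left₀ two_ne_zero (norm_nonneg v) (by nlinarith [norm_sq_eq v])

lemma abs_bilin_le (hA : IsAdmissibleCoefficient Ω A α β) (v ψ : H10 Ω) :
    |bilin A v ψ| ≤ β * ‖v‖ * ‖ψ‖ := by
  have hβ := hA.beta_pos
  have key : |bilin A v ψ| ≤ β * ‖grad v‖ * ‖grad ψ‖ := by
    refine abs_le'.2 ⟨hA.bounded v ψ, ?_⟩
    -- The hypothesis is one-sided; testing with `-ψ` gives the other sign.
    have h := hA.bounded v ((-1 : ℝ) • ψ)
    rw [bilin_smul_right, map_smul, norm_smul] at h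
    simpa using h
  refine key.trans ?_
  gcongr
  exacts [norm_grad_le v, norm_grad_le ψ]

/-- The bilinear form `a` as a bounded bilinear form on `H¹₀(Ω)`. -/
def bilinCLM (hA : IsAdmissibleCoefficient Ω A α β) : H10 Ω →L[ℝ] H10 Ω →L[ℝ] ℝ :=
  LinearMap.mkContinuous₂
    (LinearMap.mk₂ ℝ (bilin A) (bilin_add_left hA) (bilin_smul_left A)
      (fun v w ψ => bilin_add_right hA w ψ v) (fun c v ψ => bilin_smul_right A c ψ v))
    β (abs_bilin_le hA)

@[simp]
lemma bilinCLM_apply (hA : IsAdmissibleCoefficient Ω A α β) (v ψ : H10 Ω) :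
    bilinCLM hA v ψ = bilin A v ψ := rfl

end Bilin

/-! ### The Poincaré inequality and Lax–Milgram. -/

section Poincare

lemma gradient_add_of_contDiff {φ ψ : Rd d → ℝ} (hφ : ContDiff ℝ ∞ φ) (hψ : ContDiff ℝ ∞ ψ) :
    gradient (φ + ψ) = gradient φ + gradient ψ := by
  ext1 x
  simp only [gradient, Pi.add_apply]
  rw [fderiv_add (hφ.differentiable (by simp) x) (hψ.differentiable (by simp) x), map_add]

lemma gradient_smul_of_contDiff (c : ℝ) {φ : Rd d → ℝ} (hφ : ContDiff ℝ ∞ φ) :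
    gradient (c • φ) = c • gradient φ := by
  ext1 x
  simp only [gradient, Pi.smul_apply]
  rw [fderiv_const_smul (hφ.differentiable (by simp) x)]
  simp

/-- Test functions already form a vector space, so a closed condition on `H¹₀(Ω)` need only be
checked on `testGraph Ω`. -/
lemma span_testGraph : (Submodule.span ℝ (testGraph Ω) : Set (GraphSpace Ω)) = testGraph Ω := by
  refine (Set.Subset.antisymm ?_ Submodule.subset_span)
  intro p hp
  induction hp using Submodule.span_induction with
  | mem p h => exact h
  | zero =>
    refine ⟨0, contDiff_const, HasCompactSupport.zero, by simp [tsupport], ?_, ?_⟩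
    · exact Lp.coeFn_zero _ _ _
    · refine (Lp.coeFn_zero _ _ _).trans (.of_forall fun x => ?_)
      simp [gradient]
  | add p q _ _ hp hq =>
    obtain ⟨φ, hφ, hφc, hφs, hφ1, hφ2⟩ := hp
    obtain ⟨ψ, hψ, hψc, hψs, hψ1, hψ2⟩ := hq
    refine ⟨φ + ψ, hφ.add hψ, hφc.add hψc,
      (tsupport_add φ ψ).trans (union_subset hφs hψs), ?_, ?_⟩
    · exact (Lp.coeFn_add p.fst q.fst).trans (hφ1.add hψ1)
    · rw [gradient_add_of_contDiff hφ hψ]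
      exact (Lp.coeFn_add p.snd q.snd).trans (hφ2.add hψ2)
  | smul c p _ hp =>
    obtain ⟨φ, hφ, hφc, hφs, hφ1, hφ2⟩ := hp
    refine ⟨c • φ, contDiff_const.smul hφ, hφc.smul_left (f := fun _ => c),
      (tsupport_smul_subset_right (fun _ => c) φ).trans hφs, ?_, ?_⟩
    · exact (Lp.coeFn_smul c p.fst).trans (hφ1.const_smul c)
    · rw [gradient_smul_of_contDiff c hφ]
      exact (Lp.coeFn_smul c p.snd).trans (hφ2.const_smul c)

/-- The Poincaré inequality for test functions supported in a ball of radius `R`. -/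
lemma integral_sq_le_of_tsupport_subset [NeZero d] {φ : Rd d → ℝ} (hφ : ContDiff ℝ ∞ φ)
    (hc : HasCompactSupport φ) {R : ℝ} (hR : ∀ x ∈ tsupport φ, ‖x‖ ≤ R) :
    ∫ x, φ x ^ 2 ≤ 4 * R ^ 2 * ∫ x, ‖gradient φ x‖ ^ 2 := by
  -- A first coordinate direction exists because `d ≠ 0`; for `d = 0` gradients vanish and the
  -- inequality fails.
  set e : Rd d := EuclideanSpace.single 0 1
  have hdiff : Differentiable ℝ φ := hφ.differentiable (by simp)
  have hcf : HasCompactSupport (fderiv ℝ φ) := hc.fderiv ℝ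
  have hcont : Continuous (fderiv ℝ φ) := hφ.continuous_fderiv (by simp)
  have hgc : Continuous (gradient φ) :=
    (InnerProductSpace.toDual ℝ (Rd d)).symm.continuous.comp hcont
  have hcg : HasCompactSupport (gradient φ) :=
    hcf.comp_left (g := (InnerProductSpace.toDual ℝ (Rd d)).symm) (map_zero _)
  have hfd : ∀ x, fderiv ℝ (fun x => φ x ^ 2) x e = 2 * φ x * fderiv ℝ φ x e := by
    intro x
    rw [fderiv_fun_pow _ (hdiff x)]
    simp
  set L : Rd d →L[ℝ] ℝ := EuclideanSpace.proj 0
  have hLe : L e = 1 := by simp [L, e]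
  have hphi := hφ.continuous
  have i1 : Integrable (fun x => φ x ^ 2) :=
    (by fun_prop : Continuous fun x => φ x ^ 2).integrable_of_hasCompactSupport
      (hc.comp_left (g := fun y => y ^ 2) (by simp))
  have i2 : Integrable (fun x => ‖gradient φ x‖ ^ 2) :=
    (by fun_prop : Continuous fun x => ‖gradient φ x‖ ^ 2).integrable_of_hasCompactSupport
      (hcg.comp_left (g := fun y => ‖y‖ ^ 2) (by simp))
  have i3 : Integrable (fun x => 2 * φ x * fderiv ℝ φ x e * L x) := by
    refine Continuous.integrable_of_hasCompactSupport (by fun_prop) ?_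
    refine hc.mono fun x hx => ?_
    simp only [Function.mem_support] at hx ⊢
    rintro h; simp [h] at hx
  have i4 : Integrable (fun x => φ x ^ 2 * L x) := by
    refine Continuous.integrable_of_hasCompactSupport (by fun_prop) ?_
    refine hc.mono fun x hx => ?_
    simp only [Function.mem_support] at hx ⊢
    rintro h; simp [h] at hx
  -- Since `∂₀ x₀ = 1`, integration by parts gives `∫ φ² = -∫ 2 φ ∂₀φ x₀`.
  have key := integral_mul_fderiv_eq_neg_fderiv_mul_of_integrable (μ := volume)
    (f := fun x => φ x ^ 2) (g := L) (v := e)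
    (by simpa only [hfd] using i3) (by simpa [hLe] using i1) i4
    (fun x _ => (hdiff x).pow 2) (fun x _ => L.differentiableAt)
  simp only [ContinuousLinearMap.fderiv, hLe, mul_one, hfd] at key
  -- Young's inequality, from `(φ + 2y)² ≥ 0` with `y = x₀ ∂₀φ` and `|y| ≤ R ‖∇φ‖`. Absorbing `½ ∫
  -- φ²` on the left produces the constant `4 R²`.
  have hpt : ∀ x, -(2 * φ x * fderiv ℝ φ x e * L x) ≤
      (1 / 2) * φ x ^ 2 + 2 * R ^ 2 * ‖gradient φ x‖ ^ 2 := by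
    intro x
    by_cases hx : x ∈ tsupport φ
    · have h1 : |L x| ≤ R := (PiLp.norm_apply_le x 0).trans (hR x hx)
      have h2 : |fderiv ℝ φ x e| ≤ ‖gradient φ x‖ := by
        have : fderiv ℝ φ x e = inner ℝ (gradient φ x) e := by
          simp [gradient]
        rw [this]
        refine (abs_real_inner_le_norm _ _).trans ?_
        simp [e]
      have h3 : |fderiv ℝ φ x e * L x| ≤ ‖gradient φ x‖ * R := by
        rw [abs_mul]; gcongr
      have h4 : (fderiv ℝ φ x e * L x) ^ 2 ≤ (‖gradient φ x‖ * R) ^ 2 :=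
        sq_le_sq' (abs_le.1 h3).1 (abs_le.1 h3).2
      nlinarith [sq_nonneg (φ x + 2 * (fderiv ℝ φ x e * L x))]
    · have : φ x = 0 := image_eq_zero_of_notMem_tsupport hx
      rw [this]; simp; positivity
  have := integral_mono i3.neg ((i1.const_mul (1 / 2)).add (i2.const_mul (2 * R ^ 2))) hpt
  simp only [Pi.neg_apply, Pi.add_apply] at this
  rw [integral_neg, ← key, integral_add (i1.const_mul _) (i2.const_mul _), integral_const_mul,
    integral_const_mul] at this
  linarith

lemma norm_sq_eq_integral {E : Type*} [NormedAddCommGroup E] [InnerProductSpace ℝ E]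
    {X : Type*} [MeasurableSpace X] {μ : Measure X} (v : Lp E 2 μ) :
    ‖v‖ ^ 2 = ∫ x, ‖v x‖ ^ 2 ∂μ := by
  rw [← real_inner_self_eq_norm_sq, L2.inner_def]
  simp

/-- The Poincaré inequality in `H¹₀(Ω)`. -/
lemma exists_norm_fn_sq_le [NeZero d] (hΩ : Bornology.IsBounded Ω) :
    ∃ C : ℝ, 0 ≤ C ∧ ∀ v : H10 Ω, ‖fn v‖ ^ 2 ≤ C * ‖grad v‖ ^ 2 := by
  obtain ⟨R, hR⟩ := hΩ.exists_norm_le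
  refine ⟨4 * R ^ 2, by positivity, fun v => ?_⟩
  have hv : (v : GraphSpace Ω) ∈ closure (testGraph Ω) := by
    rw [← span_testGraph]; exact v.2
  have hcl : IsClosed {p : GraphSpace Ω | ‖p.fst‖ ^ 2 ≤ 4 * R ^ 2 * ‖p.snd‖ ^ 2} :=
    isClosed_le (((WithLp.fstL 2 ℝ (L2 Ω) (L2Vec Ω)).continuous.norm).pow 2)
      ((((WithLp.sndL 2 ℝ (L2 Ω) (L2Vec Ω)).continuous.norm).pow 2).const_mul _)
  refine closure_minimal ?_ hcl hv
  rintro p ⟨φ, hφ, hc, hs, h1, h2⟩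
  have e1 : ‖p.fst‖ ^ 2 = ∫ x, φ x ^ 2 := by
    rw [norm_sq_eq_integral,
      ← setIntegral_eq_integral_of_forall_compl_eq_zero (s := Ω) (f := fun x => φ x ^ 2)]
    · exact integral_congr_ae (h1.mono fun x hx => by simp only [hx, Real.norm_eq_abs, sq_abs])
    · intro x hx
      simp [image_eq_zero_of_notMem_tsupport (fun h => hx (hs h))]
  have e2 : ‖p.snd‖ ^ 2 = ∫ x, ‖gradient φ x‖ ^ 2 := by
    rw [norm_sq_eq_integral, ← setIntegral_eq_integral_of_forall_compl_eq_zero (s := Ω)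
      (f := fun x => ‖gradient φ x‖ ^ 2)]
    · exact integral_congr_ae (h2.mono fun x hx => by simp only [hx])
    · intro x hx
      have : fderiv ℝ φ x = 0 :=
        image_eq_zero_of_notMem_tsupport fun h => hx (hs (tsupport_fderiv_subset ℝ h))
      simp [gradient, this]
  rw [mem_ofPred_eq, e1, e2]
  exact integral_sq_le_of_tsupport_subset hφ hc fun x hx => hR x (hs hx)

end Poincare

/-- The Lax–Milgram lemma for `a`. -/
lemma exists_bilin_eq [NeZero d] (hΩ : Bornology.IsBounded Ω)
    {A : Rd d → Matrix (Fin d) (Fin d) ℝ} {α β : ℝ} (hA : IsAdmissibleCoefficient Ω A α β)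
    (F : StrongDual ℝ (H10 Ω)) : ∃ r : H10 Ω, ∀ φ, bilin A r φ = F φ := by
  obtain ⟨C, hC, hP⟩ := exists_norm_fn_sq_le hΩ
  have hco : IsCoercive (bilinCLM hA) := by
    -- Poincaré gives `‖v‖² ≤ (C + 1) ‖∇v‖²` for the full `H¹` norm.
    refine ⟨α / (C + 1), div_pos hA.alpha_pos (by positivity), fun v => ?_⟩
    refine le_trans ?_ (hA.coercive v)
    rw [mul_assoc, ← pow_two, div_mul_eq_mul_div, div_le_iff₀ (by positivity), norm_sq_eq,
      mul_assoc]
    exact mul_le_mul_of_nonneg_left (by linarith [hP v]) hA.alpha_pos.le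
  refine ⟨hco.continuousLinearEquivOfBilin.symm ((InnerProductSpace.toDual ℝ _).symm F),
    fun φ => ?_⟩
  rw [← bilinCLM_apply hA, ← hco.continuousLinearEquivOfBilin_apply]
  simp

/-! ### Existence of the discrete projections and of the reconstruction. -/

section Projection

lemma Triangulation.exists_mem_convexHull (τ : Triangulation Ω) {x : Rd d} (hx : x ∈ Ω) :
    ∃ K ∈ τ.elements, x ∈ convexHull ℝ (K : Set (Rd d)) := by
  have h : x ∈ τ.complex.space := by rw [τ.space_eq]; exact subset_closure hx
  obtain ⟨s, hs, hxs⟩ := Geometry.SimplicialComplex.mem_space_iff.1 h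
  obtain ⟨K, hK, hsK, hcard⟩ := τ.pure s hs
  exact ⟨K, ⟨hK, hcard⟩, convexHull_mono (by exact_mod_cast hsK) hxs⟩

instance Triangulation.finite_elements (τ : Triangulation Ω) : Finite τ.elements :=
  (τ.finite.subset fun _ h => h.1).to_subtype

/-- The pairs of a family of polynomials, one for each element, and a function in the finite element
space which agrees with them. -/
def elementwisePolynomial (τ : Triangulation Ω) (ℓ : ℕ) :
    Submodule ℝ ((τ.elements → MvPolynomial.restrictTotalDegree (Fin d) ℝ ℓ) ×
      (feSpace τ ℓ).map fn.toLinearMap) where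
  carrier := {q | ∀ K : τ.elements, ∀ᵐ x ∂(volume.restrict Ω),
    x ∈ convexHull ℝ ((K : Finset (Rd d)) : Set (Rd d)) →
      (q.2 : L2 Ω) x = MvPolynomial.eval (fun i => x i) (q.1 K : MvPolynomial (Fin d) ℝ)}
  zero_mem' := by
    intro K
    filter_upwards [Lp.coeFn_zero ℝ 2 (volume.restrict Ω)] with x hx _
    simpa using hx
  add_mem' := by
    intro p q hp hq K
    filter_upwards [hp K, hq K, Lp.coeFn_add (p.2 : L2 Ω) (q.2 : L2 Ω)] with x h1 h2 h3 hx
    rw [Prod.snd_add, Submodule.coe_add, h3, Pi.add_apply, h1 hx, h2 hx]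
    simp
  smul_mem' := by
    intro c p hp K
    filter_upwards [hp K, Lp.coeFn_smul c (p.2 : L2 Ω)] with x h1 h3 hx
    rw [Prod.smul_snd, Submodule.coe_smul, h3, Pi.smul_apply, h1 hx]
    simp [MvPolynomial.smul_eval]

/-- A linear relation replaces a linear map `P → Q`, so that polynomials need not be selected
linearly: `S` embeds in `P` and surjects onto `Q`. -/
lemma finiteDimensional_of_total_of_injective {P Q : Type*} [AddCommGroup P] [Module ℝ P]
    [AddCommGroup Q] [Module ℝ Q] [FiniteDimensional ℝ P] (S : Submodule ℝ (P × Q))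
    (hinj : ∀ q ∈ S, q.1 = 0 → q.2 = 0) (htot : ∀ y, ∃ x, (x, y) ∈ S) :
    FiniteDimensional ℝ Q := by
  have hfst : Function.Injective ((LinearMap.fst ℝ P Q).comp S.subtype) := by
    rw [← LinearMap.ker_eq_bot, LinearMap.ker_eq_bot']
    rintro ⟨q, hq⟩ h
    exact Subtype.ext (Prod.ext h (hinj q hq h))
  have hsnd : Function.Surjective ((LinearMap.snd ℝ P Q).comp S.subtype) := fun y => by
    obtain ⟨x, hx⟩ := htot y
    exact ⟨⟨(x, y), hx⟩, rfl⟩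
  have := FiniteDimensional.of_injective _ hfst
  exact Module.Finite.of_surjective _ hsnd

/-- The finitely many elements cover `Ω`, so a finite element function is determined a.e. by one
polynomial of bounded degree per element. -/
lemma finiteDimensional_map_feSpace (hΩ : MeasurableSet Ω) (τ : Triangulation Ω) (ℓ : ℕ) :
    FiniteDimensional ℝ ((feSpace τ ℓ).map fn.toLinearMap) := by
  refine finiteDimensional_of_total_of_injective (elementwisePolynomial τ ℓ) ?_ ?_
  · rintro ⟨p, w⟩ hq h
    have hp : p = 0 := h
    subst hp
    refine Subtype.ext (Lp.ext ?_)
    filter_upwards [ae_all_iff.2 hq, ae_restrict_mem hΩ, Lp.coeFn_zero ℝ 2 (volume.restrict Ω)]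
      with x hx hxΩ h0
    obtain ⟨K, hK, hxK⟩ := τ.exists_mem_convexHull hxΩ
    rw [hx ⟨K, hK⟩ hxK, Submodule.coe_zero, h0]
    simp
  · rintro ⟨_, φ, hφ, rfl⟩
    choose p hp hpφ using fun K : τ.elements => hφ K K.2
    exact ⟨fun K => ⟨p K, (MvPolynomial.mem_restrictTotalDegree _ _ _).2 (hp K)⟩, hpφ⟩

/-- The orthogonal projection onto the finite-dimensional image of `V` in `L²` exists, and any
preimage of it in `V` is a witness for `epsilon`. -/
lemma l2Proj_spec {V : Submodule ℝ (H10 Ω)} [FiniteDimensional ℝ (V.map fn.toLinearMap)]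
    (v : L2 Ω) : ∀ φ ∈ V, inner ℝ (fn (l2Proj V v : H10 Ω)) (fn φ) = inner ℝ v (fn φ) := by
  refine Classical.epsilon_spec
    (p := fun w : V => ∀ φ ∈ V, inner ℝ (fn (w : H10 Ω)) (fn φ) = inner ℝ v (fn φ)) ?_
  obtain ⟨w, hw, hwv⟩ := ((V.map fn.toLinearMap).orthogonalProjectionOnto v).2
  refine ⟨⟨w, hw⟩, fun φ hφ => ?_⟩
  have h := Submodule.starProjection_inner_eq_zero (K := V.map fn.toLinearMap) v (fn φ)
    ⟨φ, hφ, rfl⟩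
  rw [inner_sub_left, sub_eq_zero] at h
  rw [h]
  exact congrArg (fun z => inner ℝ z (fn φ)) hwv

/-- If `a(v, ·)` is represented on `V` by the `L²` function `b`, then the discrete elliptic operator
maps `v` to the `L²`-projection of `b`. -/
lemma fn_discreteElliptic_eq {V : Submodule ℝ (H10 Ω)}
    [FiniteDimensional ℝ (V.map fn.toLinearMap)] {A : Rd d → Matrix (Fin d) (Fin d) ℝ}
    {v : H10 Ω} {w : V} (hw : ∀ φ ∈ V, inner ℝ (fn (w : H10 Ω)) (fn φ) = bilin A v φ) :
    fn (discreteElliptic A V v : H10 Ω) = fn (w : H10 Ω) := by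
  have h : ∀ φ ∈ V, inner ℝ (fn (discreteElliptic A V v : H10 Ω)) (fn φ) = bilin A v φ :=
    Classical.epsilon_spec
      (p := fun w : V => ∀ φ ∈ V, inner ℝ (fn (w : H10 Ω)) (fn φ) = bilin A v φ) ⟨w, hw⟩
  -- The difference of two representers lies in `V` and is tested against itself. This identifies
  -- them as `L²` functions, which is all that is needed.
  rw [← sub_eq_zero, ← map_sub, ← inner_self_eq_zero (𝕜 := ℝ)]
  have hmem := V.sub_mem (discreteElliptic A V v).2 w.2
  nth_rewrite 1 [map_sub]
  rw [inner_sub_left, h _ hmem, hw _ hmem, sub_self]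

lemma bilin_reconstruction [NeZero d] (hΩ : Bornology.IsBounded Ω)
    {A : Rd d → Matrix (Fin d) (Fin d) ℝ} {α β : ℝ} (hA : IsAdmissibleCoefficient Ω A α β)
    (V : Submodule ℝ (H10 Ω)) (v φ : H10 Ω) :
    bilin A (reconstruction A V v) φ = inner ℝ (fn (discreteElliptic A V v : H10 Ω)) (fn φ) :=
  Classical.epsilon_spec (p := fun r : H10 Ω =>
    ∀ φ : H10 Ω, bilin A r φ = inner ℝ (fn (discreteElliptic A V v : H10 Ω)) (fn φ))
    (exists_bilin_eq hΩ hA (toHMinusOne _)) φ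

end Projection

/-! ### Piecewise linear interpolation in time. -/

section PiecewiseLinear

variable {T : ℝ} {N : ℕ} {t : ℕ → ℝ}

lemma IsPartition.lt_of_lt (ht : IsPartition T N t) {m n : ℕ} (hmn : m < n) (hn : n ≤ N) :
    t m < t n := by
  induction n, hmn using Nat.le_induction with
  | base => exact ht.lt m hn
  | succ n _ ih => exact (ih (by omega)).trans (ht.lt n hn)

lemma IsPartition.le_of_le (ht : IsPartition T N t) {m n : ℕ} (hmn : m ≤ n) (hn : n ≤ N) :
    t m ≤ t n := by
  rcases hmn.eq_or_lt with rfl | h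
  exacts [le_rfl, (ht.lt_of_lt h hn).le]

lemma IsPartition.exists_mem_Ico (ht : IsPartition T N t) {s : ℝ} (hs : s ∈ Ico 0 T) :
    ∃ n < N, s ∈ Ico (t n) (t (n + 1)) := by
  have key : ∀ m ≤ N, s < t m → ∃ n < m, s ∈ Ico (t n) (t (n + 1)) := by
    intro m
    induction m with
    | zero => intro _ h; rw [ht.zero] at h; exact absurd hs.1 (not_le.2 h)
    | succ m ih =>
      intro hm h
      rcases lt_or_ge s (t m) with h' | h'
      · obtain ⟨n, hn, hsn⟩ := ih (by omega) h'
        exact ⟨n, by omega, hsn⟩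
      · exact ⟨m, by omega, h', h⟩
  exact key N le_rfl (ht.last ▸ hs.2)

lemma hat_left (ht : IsPartition T N t) {n : ℕ} (hn : n < N) {s : ℝ}
    (hs : s ∈ Icc (t n) (t (n + 1))) :
    hat N t n s = (t (n + 1) - s) / timeStep t (n + 1) := by
  rw [hat]
  split_ifs with h1 h2
  -- At the node itself the rising branch of `hat` is selected first; both branches equal `1` there.
  · have hsn : s = t n := le_antisymm h1.2.2 hs.1
    have h3 := ht.lt_of_lt (m := n - 1) (n := n) (by omega) hn.le
    have h4 := ht.lt n hn
    rw [hsn, timeStep, timeStep, Nat.add_sub_cancel, div_self (by linarith), div_self (by linarith)]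
  · rfl
  · exact absurd ⟨hn, hs⟩ h2

lemma hat_right {n : ℕ} {s : ℝ} (hs : s ∈ Icc (t n) (t (n + 1))) :
    hat N t (n + 1) s = (s - t n) / timeStep t (n + 1) := by
  rw [hat, if_pos ⟨by omega, by simpa using hs⟩, Nat.add_sub_cancel]

lemma hat_of_ne (ht : IsPartition T N t) {n : ℕ} (hn : n < N) {s : ℝ}
    (hs : s ∈ Icc (t n) (t (n + 1))) {m : ℕ} (hm : m ≤ N) (h1 : m ≠ n) (h2 : m ≠ n + 1) :
    hat N t m s = 0 := by
  rw [hat]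
  split_ifs with h3 h4
  · rcases lt_or_gt_of_ne h1 with h | h
    · exact absurd (h3.2.2.trans_lt (ht.lt_of_lt h hn.le)) (not_lt.2 hs.1)
    -- The closed supports can meet `[t_n, t_{n+1}]` only in a common node, where the hat function
    -- vanishes.
    · have := ht.le_of_le (m := n + 1) (n := m - 1) (by omega) (by omega)
      rw [show s = t (m - 1) by linarith [h3.2.1, hs.2], sub_self, zero_div]
  · rcases lt_or_gt_of_ne h1 with h | h
    · have := ht.le_of_le (m := m + 1) (n := n) (by omega) (by omega)
      rw [show s = t (m + 1) by linarith [h4.2.2, hs.1], sub_self, zero_div]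
    · exact absurd (h4.2.1.trans hs.2) (not_le.2 (ht.lt_of_lt (by omega) hm))
  · rfl

lemma pwLinear_eq {X : Type*} [AddCommGroup X] [Module ℝ X] (ht : IsPartition T N t) (W : ℕ → X)
    {n : ℕ} (hn : n < N) {s : ℝ} (hs : s ∈ Icc (t n) (t (n + 1))) :
    pwLinear N t W s = ((t (n + 1) - s) / timeStep t (n + 1)) • W n +
      ((s - t n) / timeStep t (n + 1)) • W (n + 1) := by
  rw [pwLinear, ← hat_left ht hn hs, ← hat_right (N := N) hs,
    ← Finset.sum_pair (f := fun m => hat N t m s • W m) (by omega : n ≠ n + 1)]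
  refine (Finset.sum_subset ?_ ?_).symm
  · intro m hm
    simp only [Finset.mem_insert, Finset.mem_singleton, Finset.mem_range] at hm ⊢
    omega
  · intro m hm hm'
    simp only [Finset.mem_insert, Finset.mem_singleton, Finset.mem_range, not_or] at hm hm'
    rw [hat_of_ne ht hn hs (by omega) hm'.1 hm'.2, zero_smul]

lemma pwLinear_node {X : Type*} [AddCommGroup X] [Module ℝ X] (ht : IsPartition T N t) (W : ℕ → X)
    {n : ℕ} (hn : n < N) : pwLinear N t W (t (n + 1)) = W (n + 1) := by
  have h := ht.lt n hn
  rw [pwLinear_eq ht W hn (right_mem_Icc.2 h.le), sub_self, zero_div, zero_smul, zero_add,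
    timeStep, Nat.add_sub_cancel, div_self (by linarith), one_smul]

lemma map_pwLinear {X Y F : Type*} [AddCommGroup X] [Module ℝ X] [AddCommGroup Y] [Module ℝ Y]
    [FunLike F X Y] [LinearMapClass F ℝ X Y] (L : F) (W : ℕ → X) (s : ℝ) :
    L (pwLinear N t W s) = pwLinear N t (fun n => L (W n)) s := by
  simp [pwLinear, map_sum, map_smul]

/-- The piecewise constant derivative of the piecewise linear interpolation `pwLinear N t W`. -/
def pwSlope {X : Type*} [AddCommGroup X] [Module ℝ X] (N : ℕ) (t : ℕ → ℝ) (W : ℕ → X) (s : ℝ) : X :=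
  ∑ n ∈ Finset.range N,
    (Ico (t n) (t (n + 1))).indicator (fun _ => (timeStep t (n + 1))⁻¹ • (W (n + 1) - W n)) s

lemma pwSlope_eq {X : Type*} [AddCommGroup X] [Module ℝ X] (ht : IsPartition T N t) (W : ℕ → X)
    {n : ℕ} (hn : n < N) {s : ℝ} (hs : s ∈ Ico (t n) (t (n + 1))) :
    pwSlope N t W s = (timeStep t (n + 1))⁻¹ • (W (n + 1) - W n) := by
  rw [pwSlope, Finset.sum_eq_single_of_mem n (Finset.mem_range.2 hn), indicator_of_mem hs]
  intro m hm hmn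
  rw [Finset.mem_range] at hm
  refine indicator_of_notMem (fun h => ?_) _
  rcases lt_or_gt_of_ne hmn with h' | h'
  · exact absurd (h.2.trans_le (ht.le_of_le h' hn.le)) (not_lt.2 hs.1)
  · exact absurd (hs.2.trans_le (ht.le_of_le h' hm.le)) (not_lt.2 h.1)

section Normed

variable {X : Type*} [NormedAddCommGroup X] [NormedSpace ℝ X]

lemma memLp_pwSlope (W : ℕ → X) (p : ENNReal) :
    MemLp (pwSlope N t W) p (volume.restrict (Ioo 0 T)) :=
  memLp_finsetSum _ fun _ _ => (memLp_const _).indicator measurableSet_Ico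

lemma hasDerivAt_pwLinear (ht : IsPartition T N t) (W : ℕ → X) {n : ℕ} (hn : n < N) {s : ℝ}
    (hs : s ∈ Ioo (t n) (t (n + 1))) :
    HasDerivAt (pwLinear N t W) (pwSlope N t W s) s := by
  rw [pwSlope_eq ht W hn (Ioo_subset_Ico_self hs)]
  have h1 : HasDerivAt (fun s => ((t (n + 1) - s) / timeStep t (n + 1)) • W n +
      ((s - t n) / timeStep t (n + 1)) • W (n + 1))
      ((-1 / timeStep t (n + 1)) • W n + (1 / timeStep t (n + 1)) • W (n + 1)) s :=
    ((((hasDerivAt_id s).const_sub _).div_const _).smul_const _).add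
      ((((hasDerivAt_id s).sub_const _).div_const _).smul_const _)
  have h2 : pwLinear N t W =ᶠ[nhds s] fun s => ((t (n + 1) - s) / timeStep t (n + 1)) • W n +
      ((s - t n) / timeStep t (n + 1)) • W (n + 1) := by
    filter_upwards [isOpen_Ioo.mem_nhds hs] with r hr
    exact pwLinear_eq ht W hn (Ioo_subset_Icc_self hr)
  convert h1.congr_of_eventuallyEq h2 using 1
  rw [neg_div, neg_smul, one_div, smul_sub]
  abel

lemma continuousOn_pwLinear (ht : IsPartition T N t) (W : ℕ → X) :
    ContinuousOn (pwLinear N t W) (Icc 0 T) := by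
  rw [← ht.zero, ← ht.last]
  have key : ∀ m ≤ N, ContinuousOn (pwLinear N t W) (Icc (t 0) (t m)) := by
    intro m
    induction m with
    | zero => intro _; rw [Icc_self]; exact continuousOn_singleton _ _
    | succ m ih =>
      intro hm
      rw [← Icc_union_Icc_eq_Icc (ht.le_of_le (Nat.zero_le m) (by omega)) (ht.lt m hm).le]
      refine (ih (by omega)).union_of_isClosed ?_ isClosed_Icc isClosed_Icc
      refine ContinuousOn.congr ?_ fun s hs => pwLinear_eq ht W hm hs
      fun_prop
  exact key N le_rfl

end Normed

/-! ### Weak time derivatives. -/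

lemma integrableOn_smul_of_continuous {X : Type*} [NormedAddCommGroup X] [NormedSpace ℝ X]
    {η : ℝ → ℝ} (hη : Continuous η) (hc : HasCompactSupport η) {v : ℝ → X} {s : Set ℝ}
    (hv : IntegrableOn v s) : IntegrableOn (fun r => η r • v r) s := by
  obtain ⟨C, hC⟩ := hc.exists_bound_of_continuous hη
  exact hv.bdd_smul C hη.aestronglyMeasurable (.of_forall hC)

lemma IsTimeDeriv.sub {v v' w w' : ℝ → L2 Ω} (hv : IsTimeDeriv T v v') (hw : IsTimeDeriv T w w') :
    IsTimeDeriv T (fun s => v s - w s) (fun s => v' s - w' s) where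
  integrable := hv.integrable.sub hw.integrable
  memLp := hv.memLp.sub hw.memLp
  integral_eq η hη hc hs := by
    have hc' : HasCompactSupport (deriv η) := hc.deriv
    have hd : Continuous (deriv η) := hη.continuous_deriv (by simp)
    have iv : IntegrableOn v' (Ioo 0 T) := hv.memLp.integrable (by norm_num)
    have iw : IntegrableOn w' (Ioo 0 T) := hw.memLp.integrable (by norm_num)
    simp only [smul_sub]
    rw [integral_sub (integrableOn_smul_of_continuous hd hc' hv.integrable)
        (integrableOn_smul_of_continuous hd hc' hw.integrable),
      integral_sub (integrableOn_smul_of_continuous hη.continuous hc iv)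
        (integrableOn_smul_of_continuous hη.continuous hc iw),
      hv.integral_eq η hη hc hs, hw.integral_eq η hη hc hs]
    abel

/-- The product of `η` with the interpolant is continuous, vanishes at `0` and `T`, and is
differentiable off the countable set of nodes; the fundamental theorem of calculus allows such an
exceptional set. -/
lemma isTimeDeriv_pwLinear (hT : 0 < T) (ht : IsPartition T N t) (W : ℕ → L2 Ω) :
    IsTimeDeriv T (pwLinear N t W) (pwSlope N t W) where
  integrable := (continuousOn_pwLinear ht W).integrableOn_Icc.mono_set Ioo_subset_Icc_self
  memLp := memLp_pwSlope W 2
  integral_eq η hη hc hs := by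
    have hd : Continuous (deriv η) := hη.continuous_deriv (by simp)
    have i1 := integrableOn_smul_of_continuous hd hc.deriv
      ((continuousOn_pwLinear ht W).integrableOn_Icc.mono_set Ioo_subset_Icc_self)
    have i2 : IntegrableOn (fun r => η r • pwSlope N t W r) (Ioo 0 T) :=
      integrableOn_smul_of_continuous hη.continuous hc
        ((memLp_pwSlope W 2).integrable (by norm_num))
    have h0 : η 0 = 0 := image_eq_zero_of_notMem_tsupport fun h => lt_irrefl _ (hs h).1
    have h1 : η T = 0 := image_eq_zero_of_notMem_tsupport fun h => lt_irrefl _ (hs h).2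
    rw [eq_neg_iff_add_eq_zero, ← integral_add i1 i2, ← integral_Ioc_eq_integral_Ioo,
      ← intervalIntegral.integral_of_le hT.le]
    rw [integral_eq_of_hasDerivAt_off_countable (fun r => η r • pwLinear N t W r) _
      (countable_range t), h0, h1, zero_smul, zero_smul, sub_zero]
    · rw [uIcc_of_le hT.le]
      exact hη.continuous.continuousOn.smul (continuousOn_pwLinear ht W)
    · rintro s ⟨hs, hst⟩
      rw [min_eq_left hT.le, max_eq_right hT.le] at hs
      obtain ⟨n, hn, hsn⟩ := ht.exists_mem_Ico (Ioo_subset_Ico_self hs)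
      have hne : t n ≠ s := fun h => hst ⟨n, h⟩
      rw [add_comm]
      exact ((hη.differentiable (by simp) s).hasDerivAt).smul
        (hasDerivAt_pwLinear ht W hn ⟨lt_of_le_of_ne hsn.1 hne, hsn.2⟩)
    · rw [intervalIntegrable_iff_integrableOn_Ioo_of_le hT.le]
      exact i1.add i2

end PiecewiseLinear

/-- The weak equation holds, at almost every time, for all test functions simultaneously. -/
lemma ae_forall_of_forall_ae {T α β : ℝ} {A : Rd d → Matrix (Fin d) (Fin d) ℝ}
    (hA : IsAdmissibleCoefficient Ω A α β) {f u' : ℝ → L2 Ω} {u : ℝ → H10 Ω}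
    (h : ∀ φ : H10 Ω, ∀ᵐ s ∂(volume.restrict (Ioo 0 T)),
      toHMinusOne (u' s) φ + bilin A (u s) φ = inner ℝ (f s) (fn φ)) :
    ∀ᵐ s ∂(volume.restrict (Ioo 0 T)), ∀ φ : H10 Ω,
      toHMinusOne (u' s) φ + bilin A (u s) φ = inner ℝ (f s) (fn φ) := by
  filter_upwards [ae_all_iff.2 fun n => h (TopologicalSpace.denseSeq (H10 Ω) n)] with s hs
  -- Both sides are continuous in `φ` and agree on a countable dense set.
  refine congrFun ((TopologicalSpace.denseRange_denseSeq (H10 Ω)).equalizer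
    (g := fun φ => toHMinusOne (u' s) φ + bilin A (u s) φ) (h := fun φ => toHMinusOne (f s) φ)
    ?_ ?_ (funext hs))
  · exact (toHMinusOne (u' s)).continuous.add (bilinCLM hA (u s)).continuous
  · exact (toHMinusOne (f s)).continuous

end ParabolicFEM

end

/-! ### The error equation. -/

open ParabolicFEM in
theorem lemma1p2 {d : ℕ} (hd : 1 ≤ d) {Ω : Set (Rd d)} (hΩ : IsConvexPolygonalDomain Ω)
    {T : ℝ} (hT : 0 < T)
    {A : Rd d → Matrix (Fin d) (Fin d) ℝ} {α β : ℝ} (hA : IsAdmissibleCoefficient Ω A α β)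
    {f : ℝ → L2 Ω} (hf : MemLp f 2 (volume.restrict (Ioo 0 T)))
    {g : H10 Ω} {u : ℝ → H10 Ω} (hu : IsSolution T A f g u)
    {N : ℕ} {t : ℕ → ℝ} (ht : IsPartition T N t)
    (τ : ℕ → Triangulation Ω) (ℓ : ℕ)
    {V : ℕ → Submodule ℝ (H10 Ω)} (hV : V = fun n => feSpace (τ n) ℓ)
    {I₀ : H10 Ω → V 0} {U : ℕ → H10 Ω} (hU : IsFullyDiscreteSolution N t A V f g I₀ U)
    {ω ρ ε : ℝ → H10 Ω}
    (hω : ω = pwLinear N t fun n => reconstruction A (V n) (U n))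
    (hρ : ρ = fun s => ω s - u s)
    (hε : ε = fun s => ω s - pwLinear N t U s) :
    ∃ dρ dε : ℝ → L2 Ω,
      IsTimeDeriv T (fun s => fn (ρ s)) dρ ∧ IsTimeDeriv T (fun s => fn (ε s)) dε ∧
      ∀ n, 1 ≤ n → n ≤ N → ∀ᵐ s ∂(volume.restrict (Ico (t (n - 1)) (t n))), ∀ φ : H10 Ω,
        toHMinusOne (dρ s) φ + bilin A (ρ s) φ =
          inner ℝ (dε s) (fn φ) + bilin A (ω s - ω (t n)) φ +
          inner ℝ (fn (l2Proj (V n) (f (t n)) : H10 Ω) - f s) (fn φ) +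
          (timeStep t n)⁻¹ *
            inner ℝ (fn (l2Proj (V n) (fn (U (n - 1))) : H10 Ω) - fn (U (n - 1))) (fn φ) := by
  subst hV hω hρ hε
  obtain ⟨-, ⟨u', hu', heq⟩, -⟩ := hu
  have : NeZero d := ⟨by omega⟩
  have hbd := hΩ.isBounded
  have hfin := fun n => finiteDimensional_map_feSpace hΩ.isOpen.measurableSet (τ n) ℓ
  set W : ℕ → H10 Ω := fun n => reconstruction A (feSpace (τ n) ℓ) (U n)
  refine ⟨fun s => pwSlope N t (fun n => fn (W n)) s - u' s,
    fun s => pwSlope N t (fun n => fn (W n)) s - pwSlope N t (fun n => fn (U n)) s, ?_, ?_, ?_⟩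
  · simp only [map_sub, map_pwLinear]
    exact (isTimeDeriv_pwLinear hT ht _).sub hu'
  · simp only [map_sub, map_pwLinear]
    exact (isTimeDeriv_pwLinear hT ht _).sub (isTimeDeriv_pwLinear hT ht _)
  intro n hn1 hn
  obtain ⟨n, rfl⟩ : ∃ m, n = m + 1 := ⟨n - 1, by omega⟩
  have hsub : Ico (t n) (t (n + 1)) ⊆ Ico 0 T := by
    rw [← ht.zero, ← ht.last]
    exact Ico_subset_Ico (ht.le_of_le (Nat.zero_le n) (by omega)) (ht.le_of_le hn le_rfl)
  have hae : ∀ᵐ s ∂(volume.restrict (Ico (t n) (t (n + 1)))), ∀ φ : H10 Ω,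
      toHMinusOne (u' s) φ + bilin A (u s) φ = inner ℝ (f s) (fn φ) := by
    refine ae_mono (Measure.restrict_mono hsub le_rfl) ?_
    -- The first interval contains the time `0`, which is a null set.
    rw [Measure.restrict_congr_set Ioo_ae_eq_Ico.symm]
    exact ae_forall_of_forall_ae hA heq
  simp only [Nat.add_sub_cancel]
  filter_upwards [hae, ae_restrict_mem measurableSet_Ico] with s hs hsn φ
  have hscheme := hU.scheme (n + 1) hn1 hn
  have hUmem := hU.mem (n + 1) hn1 hn
  simp only [Nat.add_sub_cancel] at hscheme
  set k := (timeStep t (n + 1))⁻¹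
  set Vn := feSpace (τ (n + 1)) ℓ
  have : FiniteDimensional ℝ (Vn.map fn.toLinearMap) := hfin (n + 1)
  -- The scheme as an identity in `V^n`: since `U^n` lies in `V^n`, only `f^n` and `U^{n-1}` need
  -- projecting.
  have hell : fn (discreteElliptic A Vn (U (n + 1)) : H10 Ω) =
      fn (l2Proj Vn (f (t (n + 1))) : H10 Ω) -
        k • (fn (U (n + 1)) - fn (l2Proj Vn (fn (U n)) : H10 Ω)) := by
    rw [fn_discreteElliptic_eq (w := l2Proj Vn (f (t (n + 1))) -
      k • (⟨U (n + 1), hUmem⟩ - l2Proj Vn (fn (U n))))]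
    · simp
    · intro ψ hψ
      have h1 := l2Proj_spec (f (t (n + 1))) ψ hψ
      have h2 := l2Proj_spec (fn (U n)) ψ hψ
      have h3 := hscheme ψ hψ
      simp only [Submodule.coe_sub, Submodule.coe_smul, map_sub, map_smul, inner_sub_left,
        real_inner_smul_left] at h1 h2 h3 ⊢
      rw [h1, h2]
      linarith
  have hrec := bilin_reconstruction hbd hA Vn (U (n + 1)) φ
  have hW : bilin A (W (n + 1)) φ = inner ℝ (fn (discreteElliptic A Vn (U (n + 1)) : H10 Ω))
    (fn φ) := hrec
  have hsφ := hs φ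
  -- Only the slope of `U` is made explicit; that of `ω` occurs in both `∂ₜρ` and `∂ₜε` and cancels.
  rw [pwLinear_node ht W hn, pwSlope_eq ht (fun n => fn (U n)) hn hsn]
  simp only [← bilinCLM_apply hA, map_sub, sub_apply] at hsφ hW ⊢
  rw [hW, hell]
  simp only [toHMinusOne, ContinuousLinearMap.comp_apply, innerSL_apply_apply, inner_sub_left,
    real_inner_smul_left] at hsφ ⊢
  linarith
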